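/- A mixture of two one-dimensional gaussians is a probability measure $p_1\,\mathrm{N}(\mu_1,\sigma_1^2)+p_2\,\mathrm{N}(\mu_2,\sigma_2^2)$ on $\mathbb{R}$ with $p_1,p_2\ge 0$, $p_1+p_2=1$. For probability measures $P,Q$ on $\mathbb{R}$ with Lebesgue densities $p,q$, let $\mathrm{H}^2(P,Q)=\frac12\int_{-\infty}^{\infty}\big(\sqrt{p(x)}-\sqrt{q(x)}\big)^2\,dx$ denote the squared Hellinger distance. There are absolute constants $c,C>0$ such that for every $\sigma\ge 1$ there exist two mixtures of two one-dimensional gaussians, $F$ with parameters $(p_i,\mu_i,\sigma_i^2)_{i=1,2}$ and $\tilde F$ with parameters $(\tilde p_i,\tilde\mu_i,\tilde\sigma_i^2)_{i=1,2}$, all component variances being positive and all mixing probabilities being at least $c$, such that 1. both $F$ and $\tilde F$ have variance exactly $\sigma^2$; 2. any two of the four means $\mu_1,\mu_2,\tilde\mu_1,\tilde\mu_2$ differ by at least $c$ and at most $C$ in absolute value; the same holds for any two of the four component variances $\sigma_1^2,\sigma_2^2,\tilde\sigma_1^2,\tilde\sigma_2^2$, and for any two of the four mixing probabilities $p_1,p_2,\tilde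 p_1,\tilde p_2$; 3. $\mathrm{H}^2(F,\tilde F)\le C\,\sigma^{-12}$. -/

import Mathlib

open MeasureTheory ProbabilityTheory
open scoped NNReal ENNReal

/-- The parameters of a mixture of two one-dimensional gaussians: mixing probabilities,
means, and variances of the two components. -/
structure GaussianMixture where
  weight : Fin 2 → ℝ
  mean : Fin 2 → ℝ
  var : Fin 2 → ℝ≥0
  weight_nonneg : ∀ i, 0 ≤ weight i
  weight_sum : weight 0 + weight 1 = 1

/-- The law of a sample: pick `i` with probability `weight i`, then sample from
the gaussian with mean `mean i` and variance `var i`. -/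
noncomputable def GaussianMixture.law (F : GaussianMixture) : Measure ℝ :=
  ∑ i, ENNReal.ofReal (F.weight i) • gaussianReal (F.mean i) (F.var i)

/-- Squared Hellinger distance `½ ∫ (√p - √q)² dx`, where `p` and `q` are the densities
with respect to Lebesgue measure (for absolutely continuous `P` and `Q`). -/
noncomputable def hellingerSq (P Q : Measure ℝ) : ℝ :=
  1 / 2 * ∫ x, (√(P.rnDeriv volume x).toReal - √(Q.rnDeriv volume x).toReal) ^ 2

/-- Any two of the numbers `x 0, x 1, y 0, y 1` differ by at least `c` and at most `C`. -/
def PairwiseSeparated (c C : ℝ) (x y : Fin 2 → ℝ) : Prop :=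
  Pairwise fun a b : Fin 2 ⊕ Fin 2 =>
    |Sum.elim x y a - Sum.elim x y b| ∈ Set.Icc c C

/-! Smoothing hides everything but low moments. A two-component mixture has five free parameters, so
matching five moments is a square polynomial system, and it can have several solutions. Take two
solutions with mean `0` and variance `1/2`, and add `t = σ² - 1/2` to every component variance, that
is, convolve with `N(0, t)`. Differences between parameters are unaffected, and both variances
become `σ²`.

Let `f, g` be the resulting densities and `φ` that of `N(0, t)`. The integral of `(f - g)² / φ` is a
quadratic form in Mehler kernels at `x = 1/t`, formally `∑ₖ (Δmₖ)² xᵏ / k!` with `Δmₖ` the moment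
differences of the unsmoothed pair (`integral_sq_sum_gaussianPDFReal_div`). The terms with `k < 6`
vanish, so the form is `O(t⁻⁶) = O(σ⁻¹²)` (`exists_sum_mehlerKernel_le`). Instead of summing the
series, the proof compares order-five Taylor polynomials of the closed form (`hasJet_mehlerKernel`).
Finally `g ≥ φ/4` bounds the Hellinger distance by this integral (`hellingerSq_law_le`,
`le_pdf_ofShift_rational`). -/

open Asymptotics Topology Filter in
/-- `f x = a₀ + a₁ x + ⋯ + a₅ x⁵ + O(x⁶)` as `x → 0`. -/
def HasJet (f : ℝ → ℝ) (a₀ a₁ a₂ a₃ a₄ a₅ : ℝ) : Prop :=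
  (fun x => f x - (a₀ + a₁ * x + a₂ * x ^ 2 + a₃ * x ^ 3 + a₄ * x ^ 4 + a₅ * x ^ 5))
    =O[𝓝 0] fun x => x ^ 6

/-! ### Calculus of Taylor jets modulo `x ^ 6`. -/

namespace HasJet

open Asymptotics Topology Filter

variable {f g : ℝ → ℝ} {a₀ a₁ a₂ a₃ a₄ a₅ b₀ b₁ b₂ b₃ b₄ b₅ : ℝ}

theorem congr_coeff (h : HasJet f a₀ a₁ a₂ a₃ a₄ a₅) (h₀ : a₀ = b₀) (h₁ : a₁ = b₁)
    (h₂ : a₂ = b₂) (h₃ : a₃ = b₃) (h₄ : a₄ = b₄) (h₅ : a₅ = b₅) :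
    HasJet f b₀ b₁ b₂ b₃ b₄ b₅ := by
  subst h₀ h₁ h₂ h₃ h₄ h₅; exact h

theorem of_eventually_sub_eq {S : ℝ → ℝ} (hS : ContinuousAt S 0)
    (h : ∀ᶠ x in 𝓝 0, f x - (a₀ + a₁ * x + a₂ * x ^ 2 + a₃ * x ^ 3 + a₄ * x ^ 4 + a₅ * x ^ 5)
      = S x * x ^ 6) : HasJet f a₀ a₁ a₂ a₃ a₄ a₅ := by
  have h1 : (fun x => S x * x ^ 6) =O[𝓝 0] fun x : ℝ => (1 : ℝ) * x ^ 6 :=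
    (hS.tendsto.isBigO_one ℝ).mul (isBigO_refl _ _)
  simp only [one_mul] at h1
  exact h1.congr' (h.mono fun x hx => hx.symm) EventuallyEq.rfl

theorem isBigO_one_of_continuousAt (hf : ContinuousAt f 0) : f =O[𝓝 0] fun _ : ℝ => (1 : ℝ) :=
  hf.tendsto.isBigO_one ℝ

theorem polynomial_isBigO_one :
    (fun x => a₀ + a₁ * x + a₂ * x ^ 2 + a₃ * x ^ 3 + a₄ * x ^ 4 + a₅ * x ^ 5)
      =O[𝓝 0] fun _ : ℝ => (1 : ℝ) :=
  isBigO_one_of_continuousAt (by fun_prop)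

theorem isBigO_one (h : HasJet f a₀ a₁ a₂ a₃ a₄ a₅) : f =O[𝓝 0] fun _ : ℝ => (1 : ℝ) := by
  have h1 : (fun x : ℝ => x ^ 6) =O[𝓝 0] fun _ : ℝ => (1 : ℝ) :=
    isBigO_one_of_continuousAt (by fun_prop)
  exact ((h.trans h1).add polynomial_isBigO_one).congr_left fun x => sub_add_cancel _ _

theorem add (hf : HasJet f a₀ a₁ a₂ a₃ a₄ a₅) (hg : HasJet g b₀ b₁ b₂ b₃ b₄ b₅) :
    HasJet (fun x => f x + g x) (a₀ + b₀) (a₁ + b₁) (a₂ + b₂) (a₃ + b₃) (a₄ + b₄) (a₅ + b₅) :=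
  (IsBigO.add hf hg).congr_left fun x => by ring

theorem const_mul (c : ℝ) (hf : HasJet f a₀ a₁ a₂ a₃ a₄ a₅) :
    HasJet (fun x => c * f x) (c * a₀) (c * a₁) (c * a₂) (c * a₃) (c * a₄) (c * a₅) :=
  (IsBigO.const_mul_left hf c).congr_left fun x => by ring

theorem mul (hf : HasJet f a₀ a₁ a₂ a₃ a₄ a₅) (hg : HasJet g b₀ b₁ b₂ b₃ b₄ b₅) :
    HasJet (fun x => f x * g x) (a₀ * b₀) (a₀ * b₁ + a₁ * b₀) (a₀ * b₂ + a₁ * b₁ + a₂ * b₀)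
      (a₀ * b₃ + a₁ * b₂ + a₂ * b₁ + a₃ * b₀)
      (a₀ * b₄ + a₁ * b₃ + a₂ * b₂ + a₃ * b₁ + a₄ * b₀)
      (a₀ * b₅ + a₁ * b₄ + a₂ * b₃ + a₃ * b₂ + a₄ * b₁ + a₅ * b₀) := by
  -- With `P, Q` the jet polynomials, `f g - P Q = (f - P) g + P (g - Q)`; `h3` handles the terms of
  -- `P Q` of degree six to ten.
  have h1 := IsBigO.mul hf hg.isBigO_one
  have h2 := (polynomial_isBigO_one (a₀ := a₀) (a₁ := a₁) (a₂ := a₂) (a₃ := a₃) (a₄ := a₄)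
    (a₅ := a₅)).mul hg
  have h3 : (fun x : ℝ => ((a₁ * b₅ + a₂ * b₄ + a₃ * b₃ + a₄ * b₂ + a₅ * b₁)
      + (a₂ * b₅ + a₃ * b₄ + a₄ * b₃ + a₅ * b₂) * x + (a₃ * b₅ + a₄ * b₄ + a₅ * b₃) * x ^ 2
      + (a₄ * b₅ + a₅ * b₄) * x ^ 3 + a₅ * b₅ * x ^ 4) * x ^ 6) =O[𝓝 0]
      fun x : ℝ => (1 : ℝ) * x ^ 6 :=
    (isBigO_one_of_continuousAt (by fun_prop)).mul (isBigO_refl _ _)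
  simp only [one_mul, mul_one] at h1 h2 h3
  exact ((h1.add h2).add h3).congr_left fun x => by ring

theorem const (c : ℝ) : HasJet (fun _ => c) c 0 0 0 0 0 :=
  of_eventually_sub_eq (S := fun _ => 0) (by fun_prop) (.of_forall fun x => by ring)

/-- A zero constant term gives `f = O(x)`, so the exponential series truncated after `f ^ 5` has
error `O(f ^ 6) = O(x ^ 6)`. -/
theorem exp (hf : HasJet f 0 a₁ a₂ a₃ a₄ a₅) :
    HasJet (fun x => Real.exp (f x)) 1 a₁ (a₂ + a₁ ^ 2 / 2) (a₃ + a₁ * a₂ + a₁ ^ 3 / 6)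
      (a₄ + a₁ * a₃ + a₂ ^ 2 / 2 + a₁ ^ 2 * a₂ / 2 + a₁ ^ 4 / 24)
      (a₅ + a₁ * a₄ + a₂ * a₃ + (a₁ ^ 2 * a₃ + a₁ * a₂ ^ 2) / 2 + a₁ ^ 3 * a₂ / 6
        + a₁ ^ 5 / 120) := by
  have hid : (fun x : ℝ => x ^ 6) =O[𝓝 0] fun x => x :=
    IsBigO.of_bound 1 (by
      filter_upwards [Metric.ball_mem_nhds (0 : ℝ) one_pos] with x hx
      rw [Metric.mem_ball, dist_zero_right] at hx
      rw [norm_pow, one_mul]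
      exact pow_le_of_le_one (norm_nonneg _) hx.le (by norm_num))
  have hpoly : (fun x => (a₁ + a₂ * x + a₃ * x ^ 2 + a₄ * x ^ 3 + a₅ * x ^ 4) * x) =O[𝓝 0]
      fun x : ℝ => (1 : ℝ) * x :=
    (isBigO_one_of_continuousAt (by fun_prop)).mul (isBigO_refl _ _)
  simp only [one_mul] at hpoly
  have hfx : f =O[𝓝 0] fun x => x :=
    ((IsBigO.trans hf hid).add hpoly).congr_left fun x => by ring
  have hf0 : Tendsto f (𝓝 0) (𝓝 0) := hfx.trans_tendsto tendsto_id
  have hexp := ((Real.exp_sub_sum_range_isBigO_pow 6).comp_tendsto hf0).trans (hfx.pow 6)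
  have h2 := hf.mul hf
  have h3 := h2.mul hf
  have h4 := h3.mul hf
  have h5 := h4.mul hf
  have hsum := ((((((const 1).add hf).add (h2.const_mul (1 / 2))).add
    (h3.const_mul (1 / 6))).add (h4.const_mul (1 / 24))).add (h5.const_mul (1 / 120)))
  refine (hexp.add hsum).congr_left fun x => ?_
  simp only [Function.comp_apply, Finset.sum_range_succ, Finset.sum_range_zero, Nat.factorial]
  push_cast
  ring

end HasJet

/-! ### Taylor expansion of the Mehler kernel. -/

/-- The moments `E Xⁿ` of a gaussian variable `X` with mean `μ` and variance `v`. -/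
def gaussianMoment (μ v : ℝ) : ℕ → ℝ
  | 0 => 1
  | 1 => μ
  | n + 2 => μ * gaussianMoment μ v (n + 1) + (n + 1) * v * gaussianMoment μ v n

/-- The Mehler-type kernel `∑ₖ E Xᵏ E Yᵏ xᵏ / k!` for gaussian `X` and `Y` with means `μ, μ'` and
variances `v, v'`, in closed form. -/
noncomputable def mehlerKernel (μ v μ' v' x : ℝ) : ℝ :=
  (√(1 - v * v' * x ^ 2))⁻¹ *
    Real.exp ((μ * μ' * x + (v' * μ ^ 2 + v * μ' ^ 2) / 2 * x ^ 2) / (1 - v * v' * x ^ 2))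

section MehlerJet

open Asymptotics Topology Filter

theorem eventually_one_sub_mul_sq_pos (q : ℝ) : ∀ᶠ x : ℝ in 𝓝 0, 0 < 1 - q * x ^ 2 := by
  have : ContinuousAt (fun x : ℝ => 1 - q * x ^ 2) 0 := by fun_prop
  exact this.eventually_const_lt (by norm_num)

theorem hasJet_inv_one_sub_mul_sq (q : ℝ) :
    HasJet (fun x => (1 - q * x ^ 2)⁻¹) 1 0 q 0 (q ^ 2) 0 := by
  refine HasJet.of_eventually_sub_eq (S := fun x => q ^ 3 * (1 - q * x ^ 2)⁻¹) ?_ ?_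
  · exact ContinuousAt.mul (by fun_prop) (ContinuousAt.inv₀ (by fun_prop) (by norm_num))
  · filter_upwards [eventually_one_sub_mul_sq_pos q] with x hx
    field_simp
    ring

/-- The remainder comes from `s - P = (s² - P²) / (s + P)`, where `s` is the inverse root and `P`
its Taylor polynomial: `s²` is rational in `x`, and `s + P` is near `2`. -/
theorem hasJet_inv_sqrt_one_sub_mul_sq (q : ℝ) :
    HasJet (fun x => (√(1 - q * x ^ 2))⁻¹) 1 0 (q / 2) 0 (3 / 8 * q ^ 2) 0 := by
  refine HasJet.of_eventually_sub_eq
    (S := fun x => (5 / 8 * q ^ 3 + 15 / 64 * q ^ 4 * x ^ 2 + 9 / 64 * q ^ 5 * x ^ 4)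
      * (1 - q * x ^ 2)⁻¹ *
      ((√(1 - q * x ^ 2))⁻¹ + (1 + q / 2 * x ^ 2 + 3 / 8 * q ^ 2 * x ^ 4))⁻¹) ?_ ?_
  · have h1 : ContinuousAt (fun x : ℝ => (√(1 - q * x ^ 2))⁻¹) 0 :=
      ContinuousAt.inv₀ (by fun_prop) (by norm_num)
    refine ContinuousAt.mul (ContinuousAt.mul (by fun_prop)
      (ContinuousAt.inv₀ (by fun_prop) (by norm_num)))
      (ContinuousAt.inv₀ (by fun_prop) (by norm_num))
  · have hc : ContinuousAt (fun x : ℝ => 1 + q / 2 * x ^ 2 + 3 / 8 * q ^ 2 * x ^ 4) 0 := by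
      fun_prop
    filter_upwards [eventually_one_sub_mul_sq_pos q,
      hc.eventually_const_lt (u := 0) (by norm_num)] with x hx hP
    have hs : 0 < (√(1 - q * x ^ 2))⁻¹ := by positivity
    have hs2 : (√(1 - q * x ^ 2))⁻¹ ^ 2 = (1 - q * x ^ 2)⁻¹ := by
      rw [inv_pow, Real.sq_sqrt hx.le]
    set s := (√(1 - q * x ^ 2))⁻¹
    set P := 1 + q / 2 * x ^ 2 + 3 / 8 * q ^ 2 * x ^ 4 with hPdef
    have key : (s - P) * (s + P)
        = (5 / 8 * q ^ 3 + 15 / 64 * q ^ 4 * x ^ 2 + 9 / 64 * q ^ 5 * x ^ 4)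
          * (1 - q * x ^ 2)⁻¹ * x ^ 6 := by
      have : (s - P) * (s + P) = s ^ 2 - P ^ 2 := by ring
      rw [this, hs2, hPdef]
      field_simp
      ring
    have hne : s + P ≠ 0 := by positivity
    have : s - P = (s - P) * (s + P) * (s + P)⁻¹ := by field_simp
    calc _ = s - P := by rw [hPdef]; ring
      _ = _ := by rw [this, key]; ring

theorem hasJet_mehlerKernel (μ v μ' v' : ℝ) :
    HasJet (mehlerKernel μ v μ' v')
      (gaussianMoment μ v 0 * gaussianMoment μ' v' 0)
      (gaussianMoment μ v 1 * gaussianMoment μ' v' 1)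
      (gaussianMoment μ v 2 * gaussianMoment μ' v' 2 / 2)
      (gaussianMoment μ v 3 * gaussianMoment μ' v' 3 / 6)
      (gaussianMoment μ v 4 * gaussianMoment μ' v' 4 / 24)
      (gaussianMoment μ v 5 * gaussianMoment μ' v' 5 / 120) := by
  have hlin : HasJet (fun x => μ * μ' * x + (v' * μ ^ 2 + v * μ' ^ 2) / 2 * x ^ 2)
      0 (μ * μ') ((v' * μ ^ 2 + v * μ' ^ 2) / 2) 0 0 0 :=
    HasJet.of_eventually_sub_eq (S := fun _ => 0) (by fun_prop) (.of_forall fun x => by ring)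
  have hE := ((hlin.mul (hasJet_inv_one_sub_mul_sq (v * v'))).congr_coeff (zero_mul _)
    rfl rfl rfl rfl rfl).exp
  refine ((hasJet_inv_sqrt_one_sub_mul_sq (v * v')).mul hE).congr_coeff
    (by simp [gaussianMoment]) ?_ ?_ ?_ ?_ ?_ <;>
  · simp only [gaussianMoment]
    push_cast
    ring

end MehlerJet

theorem continuousOn_mehlerKernel {μ v μ' v' : ℝ} {s : Set ℝ}
    (h : ∀ x ∈ s, 0 < 1 - v * v' * x ^ 2) : ContinuousOn (mehlerKernel μ v μ' v') s := by
  unfold mehlerKernel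
  refine ContinuousOn.mul (ContinuousOn.inv₀ (by fun_prop) fun x hx => ?_)
    (Real.continuous_exp.comp_continuousOn
      (ContinuousOn.div (by fun_prop) (by fun_prop) fun x hx => (h x hx).ne'))
  exact (Real.sqrt_pos.2 (h x hx)).ne'

open Asymptotics Topology Filter in
-- The jet controls `x < ε`; for `x ≥ ε` a compactness bound `M` is at most `(M / ε ^ 6) * x ^ 6`.
theorem exists_le_mul_pow_six {f : ℝ → ℝ} {b : ℝ} (hf : ContinuousOn f (Set.Icc 0 b))
    (h : HasJet f 0 0 0 0 0 0) : ∃ C, 0 < C ∧ ∀ x ∈ Set.Ioc 0 b, f x ≤ C * x ^ 6 := by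
  obtain ⟨M, hM⟩ := isCompact_Icc.exists_bound_of_continuousOn hf
  obtain ⟨C, hC0, hC⟩ := (IsBigO.exists_pos h)
  obtain ⟨ε, hε, hball⟩ := Metric.eventually_nhds_iff.1 hC.bound
  refine ⟨max C (M / ε ^ 6), lt_max_of_lt_left hC0, fun x hx => ?_⟩
  have hx0 : 0 < x := hx.1
  rcases lt_or_ge x ε with hlt | hge
  · have := hball (y := x) (by simpa [abs_of_pos hx0] using hlt)
    simp only [zero_mul, add_zero, sub_zero, norm_pow, Real.norm_eq_abs, abs_of_pos hx0] at this
    exact (le_abs_self _).trans (this.trans (by gcongr; exact le_max_left _ _))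
  · have h1 := hM x ⟨hx0.le, hx.2⟩
    have h2 : 0 ≤ M := (norm_nonneg _).trans h1
    calc f x ≤ M := (le_abs_self _).trans h1
      _ = M / ε ^ 6 * ε ^ 6 := by field_simp
      _ ≤ max C (M / ε ^ 6) * x ^ 6 := by gcongr; exact le_max_right _ _

/-- If a signed combination of gaussians has vanishing moments up to order five, then the
associated quadratic form of Mehler kernels vanishes to order six. -/
theorem exists_sum_mehlerKernel_le {ι : Type*} [Fintype ι] {b : ℝ} (w μ v : ι → ℝ)
    (hv : ∀ i j, ∀ x ∈ Set.Icc 0 b, 0 < 1 - v i * v j * x ^ 2)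
    (hmom : ∀ k < 6, ∑ i, w i * gaussianMoment (μ i) (v i) k = 0) :
    ∃ C, 0 < C ∧ ∀ x ∈ Set.Ioc 0 b,
      ∑ i, ∑ j, w i * w j * mehlerKernel (μ i) (v i) (μ j) (v j) x ≤ C * x ^ 6 := by
  refine exists_le_mul_pow_six ?_ ?_
  · exact continuousOn_finsetSum _ fun i _ => continuousOn_finsetSum _ fun j _ =>
      continuousOn_const.mul (continuousOn_mehlerKernel (hv i j))
  · have h1 := Asymptotics.IsBigO.sum (s := (Finset.univ : Finset (ι × ι))) fun p _ =>
      (hasJet_mehlerKernel (μ p.1) (v p.1) (μ p.2) (v p.2)).const_mul (w p.1 * w p.2)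
    -- Each Taylor coefficient of the form is the square of a signed moment divided by `c = k!`.
    have h0 (k : ℕ) (hk : k < 6) (c : ℝ) : ∑ p : ι × ι, w p.1 * w p.2 *
        (gaussianMoment (μ p.1) (v p.1) k * gaussianMoment (μ p.2) (v p.2) k / c) = 0 := by
      rw [Fintype.sum_prod_type]
      calc _ = (∑ i, w i * gaussianMoment (μ i) (v i) k) *
            (∑ j, w j * gaussianMoment (μ j) (v j) k) / c := by
              rw [Finset.sum_mul_sum, Finset.sum_div]
              refine Finset.sum_congr rfl fun i _ => ?_
              rw [Finset.sum_div]
              exact Finset.sum_congr rfl fun j _ => by ring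
        _ = 0 := by rw [hmom k hk]; simp
    refine h1.congr_left fun x => ?_
    have h00 := h0 0 (by norm_num) 1
    have h01 := h0 1 (by norm_num) 1
    simp only [div_one] at h00 h01
    simp only [Finset.sum_apply, Finset.sum_sub_distrib, Finset.sum_add_distrib, ← Finset.sum_mul, h00, h01,
      h0 2 (by norm_num), h0 3 (by norm_num), h0 4 (by norm_num), h0 5 (by norm_num)]
    rw [Fintype.sum_prod_type]

/-! ### Weighted `L²` products of gaussian densities. -/

/-- Completing the square: precisions combine to `1/(t+v) + 1/(t+v') - 1/t = (t² - v v') / (t (t+v)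
(t+v'))`, which `hq` makes positive. -/
theorem gaussianPDFReal_mul_div_eq {t v v' : ℝ} (ht : 0 < t) (hv : 0 ≤ v) (hv' : 0 ≤ v')
    (hq : v * v' < t ^ 2) (μ μ' y : ℝ) :
    gaussianPDFReal μ (t + v).toNNReal y * gaussianPDFReal μ' (t + v').toNNReal y
        / gaussianPDFReal 0 t.toNNReal y =
      mehlerKernel μ v μ' v' t⁻¹ * gaussianPDFReal
        (t * (μ * (t + v') + μ' * (t + v)) / (t ^ 2 - v * v'))
        (t * (t + v) * (t + v') / (t ^ 2 - v * v')).toNNReal y := by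
  have hA : 0 < t + v := by positivity
  have hA' : 0 < t + v' := by positivity
  have hd : 0 < t ^ 2 - v * v' := by linarith
  have hr : 1 - v * v' * t⁻¹ ^ 2 = (t ^ 2 - v * v') / t ^ 2 := by field_simp
  simp only [gaussianPDFReal, mehlerKernel, hr]
  rw [Real.coe_toNNReal _ hA.le, Real.coe_toNNReal _ hA'.le, Real.coe_toNNReal _ ht.le,
    Real.coe_toNNReal _ (by positivity)]
  have hpi := Real.pi_pos
  have hsq : (√(2 * Real.pi * (t + v)))⁻¹ * (√(2 * Real.pi * (t + v')))⁻¹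
      / (√(2 * Real.pi * t))⁻¹ = (√((t ^ 2 - v * v') / t ^ 2))⁻¹ *
        (√(2 * Real.pi * (t * (t + v) * (t + v') / (t ^ 2 - v * v'))))⁻¹ := by
    rw [← Real.sqrt_inv, ← Real.sqrt_inv, ← Real.sqrt_inv, ← Real.sqrt_inv, ← Real.sqrt_inv,
      ← Real.sqrt_mul (by positivity), ← Real.sqrt_mul (by positivity),
      ← Real.sqrt_div (by positivity)]
    congr 1
    field_simp
  have hexp : Real.exp (-(y - μ) ^ 2 / (2 * (t + v))) * Real.exp (-(y - μ') ^ 2 / (2 * (t + v')))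
      / Real.exp (-(y - 0) ^ 2 / (2 * t)) =
      Real.exp ((μ * μ' * t⁻¹ + (v' * μ ^ 2 + v * μ' ^ 2) / 2 * t⁻¹ ^ 2) /
        ((t ^ 2 - v * v') / t ^ 2)) *
      Real.exp (-(y - t * (μ * (t + v') + μ' * (t + v)) / (t ^ 2 - v * v')) ^ 2 /
        (2 * (t * (t + v) * (t + v') / (t ^ 2 - v * v')))) := by
    rw [← Real.exp_add, ← Real.exp_sub, ← Real.exp_add]
    congr 1
    have hd' := hd.ne'
    generalize hD : t ^ 2 - v * v' = D at *
    field_simp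
    rw [← hD]
    ring
  calc _ = ((√(2 * Real.pi * (t + v)))⁻¹ * (√(2 * Real.pi * (t + v')))⁻¹
      / (√(2 * Real.pi * t))⁻¹) * (Real.exp (-(y - μ) ^ 2 / (2 * (t + v))) *
        Real.exp (-(y - μ') ^ 2 / (2 * (t + v'))) / Real.exp (-(y - 0) ^ 2 / (2 * t))) := by
        rw [div_mul_div_comm]; congr 1; ring
    _ = _ := by rw [hsq, hexp]; ring

theorem integrable_gaussianPDFReal_mul_div {t v v' : ℝ} (ht : 0 < t) (hv : 0 ≤ v) (hv' : 0 ≤ v')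
    (hq : v * v' < t ^ 2) (μ μ' : ℝ) :
    Integrable fun y => gaussianPDFReal μ (t + v).toNNReal y *
      gaussianPDFReal μ' (t + v').toNNReal y / gaussianPDFReal 0 t.toNNReal y := by
  simp only [gaussianPDFReal_mul_div_eq ht hv hv' hq]
  exact (integrable_gaussianPDFReal _ _).const_mul _

theorem integral_gaussianPDFReal_mul_div {t v v' : ℝ} (ht : 0 < t) (hv : 0 ≤ v) (hv' : 0 ≤ v')
    (hq : v * v' < t ^ 2) (μ μ' : ℝ) :
    ∫ y, gaussianPDFReal μ (t + v).toNNReal y *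
      gaussianPDFReal μ' (t + v').toNNReal y / gaussianPDFReal 0 t.toNNReal y =
        mehlerKernel μ v μ' v' t⁻¹ := by
  have hd : 0 < t ^ 2 - v * v' := by linarith
  simp only [gaussianPDFReal_mul_div_eq ht hv hv' hq]
  rw [integral_const_mul, integral_gaussianPDFReal_eq_one, mul_one]
  exact (Real.toNNReal_pos.2 (by positivity)).ne'

/-- The quadratic form of Mehler kernels is the weighted `L²` norm of a signed combination of
gaussian densities. -/
theorem integral_sq_sum_gaussianPDFReal_div {ι : Type*} [Fintype ι] {t : ℝ} (ht : 0 < t)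
    (w μ v : ι → ℝ) (hv : ∀ i, 0 ≤ v i) (hq : ∀ i j, v i * v j < t ^ 2) :
    (Integrable fun y => (∑ i, w i * gaussianPDFReal (μ i) (t + v i).toNNReal y) ^ 2
        / gaussianPDFReal 0 t.toNNReal y) ∧
    ∫ y, (∑ i, w i * gaussianPDFReal (μ i) (t + v i).toNNReal y) ^ 2
        / gaussianPDFReal 0 t.toNNReal y =
      ∑ i, ∑ j, w i * w j * mehlerKernel (μ i) (v i) (μ j) (v j) t⁻¹ := by
  have hint (i j : ι) := (integrable_gaussianPDFReal_mul_div ht (hv i) (hv j) (hq i j)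
    (μ i) (μ j)).const_mul (w i * w j)
  have heq : (fun y => (∑ i, w i * gaussianPDFReal (μ i) (t + v i).toNNReal y) ^ 2
      / gaussianPDFReal 0 t.toNNReal y) = fun y => ∑ i, ∑ j, w i * w j *
        (gaussianPDFReal (μ i) (t + v i).toNNReal y * gaussianPDFReal (μ j) (t + v j).toNNReal y
          / gaussianPDFReal 0 t.toNNReal y) := by
    ext y
    rw [sq, Finset.sum_mul_sum, Finset.sum_div]
    refine Finset.sum_congr rfl fun i _ => ?_
    rw [Finset.sum_div]
    exact Finset.sum_congr rfl fun j _ => by ring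
  rw [heq]
  refine ⟨integrable_finsetSum _ fun i _ => integrable_finsetSum _ fun j _ => hint i j, ?_⟩
  rw [integral_finsetSum _ fun i _ => integrable_finsetSum _ fun j _ => hint i j]
  refine Finset.sum_congr rfl fun i _ => ?_
  rw [integral_finsetSum _ fun j _ => hint i j]
  refine Finset.sum_congr rfl fun j _ => ?_
  rw [integral_const_mul, integral_gaussianPDFReal_mul_div ht (hv i) (hv j) (hq i j)]

/-- A gaussian density dominates a multiple of every centred gaussian density of smaller
variance. -/
theorem mul_gaussianPDFReal_le {t v : ℝ} (ht : 0 < t) (hv : 0 < v) (μ y : ℝ) :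
    √(t / (t + v)) * Real.exp (-μ ^ 2 / (2 * v)) * gaussianPDFReal 0 t.toNNReal y ≤
      gaussianPDFReal μ (t + v).toNNReal y := by
  have hpi := Real.pi_pos
  simp only [gaussianPDFReal]
  rw [Real.coe_toNNReal _ ht.le, Real.coe_toNNReal _ (by positivity)]
  have hsq : √(t / (t + v)) * (√(2 * Real.pi * t))⁻¹ = (√(2 * Real.pi * (t + v)))⁻¹ := by
    rw [← Real.sqrt_inv, ← Real.sqrt_inv, ← Real.sqrt_mul (by positivity)]
    congr 1
    field_simp
  have hexp : Real.exp (-μ ^ 2 / (2 * v)) * Real.exp (-(y - 0) ^ 2 / (2 * t)) ≤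
      Real.exp (-(y - μ) ^ 2 / (2 * (t + v))) := by
    rw [← Real.exp_add]
    refine Real.exp_le_exp.2 ?_
    rw [← sub_nonneg]
    have : -(y - μ) ^ 2 / (2 * (t + v)) - (-μ ^ 2 / (2 * v) + -(y - 0) ^ 2 / (2 * t))
        = (v * y + t * μ) ^ 2 / (2 * v * t * (t + v)) := by
      field_simp
      ring
    rw [this]
    positivity
  calc _ = (√(t / (t + v)) * (√(2 * Real.pi * t))⁻¹) *
        (Real.exp (-μ ^ 2 / (2 * v)) * Real.exp (-(y - 0) ^ 2 / (2 * t))) := by ring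
    _ ≤ _ := by rw [hsq]; gcongr

/-- Since `p - q = (√p - √q) (√p + √q)` and `√p + √q ≥ √q`. This is the pointwise form of bounding
Hellinger distance by chi-square. -/
theorem sq_sqrt_sub_sqrt_le {p q : ℝ} (hp : 0 ≤ p) (hq : 0 < q) :
    (√p - √q) ^ 2 ≤ (p - q) ^ 2 / q := by
  have hs := Real.sqrt_pos.2 hq
  have hs' := Real.sqrt_nonneg p
  have h1 : (p - q) ^ 2 / q = (√p - √q) ^ 2 * ((√p + √q) ^ 2 / √q ^ 2) := by
    rw [Real.sq_sqrt hq.le, ← mul_div_assoc, ← mul_pow]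
    congr 2
    nlinarith [Real.sq_sqrt hp, Real.sq_sqrt hq.le]
  rw [h1]
  refine le_mul_of_one_le_right (sq_nonneg _) ?_
  rw [one_le_div (by positivity)]
  gcongr
  linarith

/-! ### Density, Hellinger bound and variance of mixtures. -/

namespace GaussianMixture

/-- The Lebesgue density of a gaussian mixture. -/
noncomputable def pdf (F : GaussianMixture) (x : ℝ) : ℝ :=
  ∑ i, F.weight i * gaussianPDFReal (F.mean i) (F.var i) x

theorem pdf_nonneg (F : GaussianMixture) (x : ℝ) : 0 ≤ F.pdf x :=
  Finset.sum_nonneg fun i _ => mul_nonneg (F.weight_nonneg i) (gaussianPDFReal_nonneg _ _ _)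

theorem law_eq_withDensity {F : GaussianMixture} (hF : ∀ i, 0 < F.var i) :
    F.law = volume.withDensity fun x => ENNReal.ofReal (F.pdf x) := by
  have h1 : (fun x => ENNReal.ofReal (F.pdf x)) =
      (ENNReal.ofReal (F.weight 0) • gaussianPDF (F.mean 0) (F.var 0)) +
      (ENNReal.ofReal (F.weight 1) • gaussianPDF (F.mean 1) (F.var 1)) := by
    ext x
    simp only [pdf, Fin.sum_univ_two, Pi.add_apply, Pi.smul_apply, smul_eq_mul, gaussianPDF]
    rw [ENNReal.ofReal_add, ENNReal.ofReal_mul (F.weight_nonneg 0),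
      ENNReal.ofReal_mul (F.weight_nonneg 1)] <;>
    exact mul_nonneg (F.weight_nonneg _) (gaussianPDFReal_nonneg _ _ _)
  rw [h1, withDensity_add_left ((measurable_gaussianPDF _ _).const_smul _),
    withDensity_smul _ (measurable_gaussianPDF _ _),
    withDensity_smul _ (measurable_gaussianPDF _ _), law, Fin.sum_univ_two,
    gaussianReal_of_var_ne_zero _ (hF 0).ne', gaussianReal_of_var_ne_zero _ (hF 1).ne']

theorem measurable_pdf (F : GaussianMixture) : Measurable F.pdf := by
  unfold pdf
  exact Finset.measurable_fun_sum _ fun i _ => (measurable_gaussianPDFReal _ _).const_mul _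

theorem rnDeriv_law {F : GaussianMixture} (hF : ∀ i, 0 < F.var i) :
    (fun x => (F.law.rnDeriv volume x).toReal) =ᵐ[volume] F.pdf := by
  rw [law_eq_withDensity hF]
  filter_upwards [Measure.rnDeriv_withDensity volume F.measurable_pdf.ennreal_ofReal] with x hx
  rw [hx, ENNReal.toReal_ofReal (F.pdf_nonneg x)]

theorem hellingerSq_law {F G : GaussianMixture} (hF : ∀ i, 0 < F.var i)
    (hG : ∀ i, 0 < G.var i) :
    hellingerSq F.law G.law = 1 / 2 * ∫ x, (√(F.pdf x) - √(G.pdf x)) ^ 2 := by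
  unfold hellingerSq
  congr 1
  refine integral_congr_ae ?_
  filter_upwards [rnDeriv_law hF, rnDeriv_law hG] with x hx hx'
  rw [hx, hx']

/-- Replaces the mixture density in the chi-square denominator by a minorant `φ`; for a single
gaussian `φ` the integral is explicit. -/
theorem hellingerSq_law_le {F G : GaussianMixture} (hF : ∀ i, 0 < F.var i)
    (hG : ∀ i, 0 < G.var i) {φ : ℝ → ℝ} {c : ℝ} (hc : 0 < c) (hφ : ∀ x, 0 < φ x)
    (hle : ∀ x, c * φ x ≤ G.pdf x) (hint : Integrable fun x => (F.pdf x - G.pdf x) ^ 2 / φ x) :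
    hellingerSq F.law G.law ≤ 1 / (2 * c) * ∫ x, (F.pdf x - G.pdf x) ^ 2 / φ x := by
  rw [hellingerSq_law hF hG]
  have h1 : ∫ x, (√(F.pdf x) - √(G.pdf x)) ^ 2 ≤
      ∫ x, 1 / c * ((F.pdf x - G.pdf x) ^ 2 / φ x) := by
    refine integral_mono_of_nonneg (.of_forall fun x => sq_nonneg _) (hint.const_mul _)
      (.of_forall fun x => ?_)
    have hcφ : 0 < c * φ x := mul_pos hc (hφ x)
    calc (√(F.pdf x) - √(G.pdf x)) ^ 2 ≤ (F.pdf x - G.pdf x) ^ 2 / G.pdf x :=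
          sq_sqrt_sub_sqrt_le (F.pdf_nonneg x) (hcφ.trans_le (hle x))
      _ ≤ (F.pdf x - G.pdf x) ^ 2 / (c * φ x) := by gcongr; exact hle x
      _ = 1 / c * ((F.pdf x - G.pdf x) ^ 2 / φ x) := by rw [div_mul_div_comm, one_mul]
  rw [integral_const_mul] at h1
  calc _ ≤ 1 / 2 * (1 / c * ∫ x, (F.pdf x - G.pdf x) ^ 2 / φ x) := by gcongr
    _ = _ := by rw [← mul_assoc, div_mul_div_comm, one_mul]

instance isProbabilityMeasure_law (F : GaussianMixture) : IsProbabilityMeasure F.law := by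
  refine ⟨?_⟩
  simp only [law, Fin.sum_univ_two, Measure.add_apply, Measure.smul_apply, measure_univ,
    smul_eq_mul, mul_one]
  rw [← ENNReal.ofReal_add (F.weight_nonneg 0) (F.weight_nonneg 1), F.weight_sum,
    ENNReal.ofReal_one]

theorem integrable_law {F : GaussianMixture} {f : ℝ → ℝ}
    (hf : ∀ μ v, Integrable f (gaussianReal μ v)) : Integrable f F.law := by
  rw [law, Fin.sum_univ_two]
  exact ((hf _ _).smul_measure ENNReal.ofReal_ne_top).add_measure
    ((hf _ _).smul_measure ENNReal.ofReal_ne_top)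

theorem integral_law {F : GaussianMixture} {f : ℝ → ℝ}
    (hf : ∀ μ v, Integrable f (gaussianReal μ v)) :
    ∫ x, f x ∂F.law = ∑ i, F.weight i * ∫ x, f x ∂gaussianReal (F.mean i) (F.var i) := by
  rw [law, Fin.sum_univ_two, Fin.sum_univ_two, integral_add_measure
    ((hf _ _).smul_measure ENNReal.ofReal_ne_top) ((hf _ _).smul_measure ENNReal.ofReal_ne_top),
    integral_smul_measure, integral_smul_measure, ENNReal.toReal_ofReal (F.weight_nonneg 0),
    ENNReal.toReal_ofReal (F.weight_nonneg 1), smul_eq_mul, smul_eq_mul]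

theorem variance_law (F : GaussianMixture) :
    Var[id; F.law] = ∑ i, F.weight i * (F.mean i ^ 2 + F.var i)
      - (∑ i, F.weight i * F.mean i) ^ 2 := by
  have h1 (μ : ℝ) (v : ℝ≥0) : Integrable (fun x : ℝ => x) (gaussianReal μ v) :=
    (memLp_id_gaussianReal 1).integrable le_rfl
  have h2 (μ : ℝ) (v : ℝ≥0) : Integrable (fun x : ℝ => x ^ 2) (gaussianReal μ v) :=
    (memLp_id_gaussianReal 2).integrable_sq
  have h3 (μ : ℝ) (v : ℝ≥0) : ∫ x, x ^ 2 ∂gaussianReal μ v = μ ^ 2 + v := by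
    have h := variance_eq_sub (memLp_id_gaussianReal (μ := μ) (v := v) 2)
    simp only [variance_id_gaussianReal, Pi.pow_apply, id_eq, integral_id_gaussianReal] at h
    linarith
  have hmem : MemLp id 2 F.law :=
    (memLp_two_iff_integrable_sq measurable_id.aestronglyMeasurable).2 (integrable_law h2)
  rw [variance_eq_sub hmem]
  simp only [Pi.pow_apply, id_eq]
  rw [integral_law h1, integral_law h2]
  simp only [h3, integral_id_gaussianReal]

end GaussianMixture

/-! ### The explicit moment-matched pair. -/

/-- The weights of a pair of gaussians, defined over `ℚ(√21)`, which has the same moments up to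
order five as the pair with parameters `rationalWeight`, `rationalMean`, `rationalVar`. -/
noncomputable def quadraticWeight : Fin 2 → ℝ := ![1 / 2 + 3 * √21 / 28, 1 / 2 - 3 * √21 / 28]

/-- The means of the pair of gaussians with weights `quadraticWeight`. -/
noncomputable def quadraticMean : Fin 2 → ℝ := ![(27 - 6 * √21) / 64, (27 + 6 * √21) / 64]

/-- The variances of the pair of gaussians with weights `quadraticWeight`. -/
noncomputable def quadraticVar : Fin 2 → ℝ :=
  ![(1049 + 216 * √21) / 4096, (1049 - 216 * √21) / 4096]

/-- The weights of a pair of gaussians with rational parameters. -/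
noncomputable def rationalWeight : Fin 2 → ℝ := ![1 / 4, 3 / 4]

/-- The means of the pair of gaussians with weights `rationalWeight`. -/
noncomputable def rationalMean : Fin 2 → ℝ := ![-27 / 64, 9 / 64]

/-- The variances of the pair of gaussians with weights `rationalWeight`. -/
noncomputable def rationalVar : Fin 2 → ℝ := ![1697 / 4096, 1841 / 4096]

theorem sqrt_twentyOne_bounds : 4.58 < √(21 : ℝ) ∧ √(21 : ℝ) < 4.59 :=
  ⟨Real.lt_sqrt_of_sq_lt (by norm_num), (Real.sqrt_lt' (by norm_num)).2 (by norm_num)⟩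

/-- The mixture with the given weights and means whose component variances are `t + v i`. -/
noncomputable def GaussianMixture.ofShift (t : ℝ) (w μ v : Fin 2 → ℝ) (h0 : ∀ i, 0 ≤ w i)
    (h1 : w 0 + w 1 = 1) : GaussianMixture where
  weight := w
  mean := μ
  var i := (t + v i).toNNReal
  weight_nonneg := h0
  weight_sum := h1

/-- The smaller weight, `1/2 - 3√21/28 ≈ 0.009`, is what forces a constant as small as `1/200`. -/
theorem quadraticWeight_ge (i : Fin 2) : 1 / 200 ≤ quadraticWeight i := by
  have := sqrt_twentyOne_bounds
  fin_cases i <;> simp [quadraticWeight] <;> linarith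

theorem quadraticWeight_sum : quadraticWeight 0 + quadraticWeight 1 = 1 := by
  simp [quadraticWeight]; ring

theorem rationalWeight_ge (i : Fin 2) : 1 / 200 ≤ rationalWeight i := by
  fin_cases i <;> norm_num [rationalWeight]

theorem rationalWeight_sum : rationalWeight 0 + rationalWeight 1 = 1 := by
  norm_num [rationalWeight]

theorem quadraticVar_mem (i : Fin 2) : quadraticVar i ∈ Set.Ioo 0 (1 / 2) := by
  have := sqrt_twentyOne_bounds
  fin_cases i <;> constructor <;> simp [quadraticVar] <;> linarith

theorem rationalVar_mem (i : Fin 2) : rationalVar i ∈ Set.Ioo 0 (1 / 2) := by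
  fin_cases i <;> constructor <;> norm_num [rationalVar]

theorem sum_quadraticWeight_mul_mean : ∑ i, quadraticWeight i * quadraticMean i = 0 := by
  have hr : √(21 : ℝ) ^ 2 = 21 := Real.sq_sqrt (by norm_num)
  simp [quadraticWeight, quadraticMean]
  linarith

theorem sum_rationalWeight_mul_mean : ∑ i, rationalWeight i * rationalMean i = 0 := by
  norm_num [rationalWeight, rationalMean]

theorem sum_quadraticWeight_mul_sq :
    ∑ i, quadraticWeight i * (quadraticMean i ^ 2 + quadraticVar i) = 1 / 2 := by
  have hr : √(21 : ℝ) ^ 2 = 21 := Real.sq_sqrt (by norm_num)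
  simp [quadraticWeight, quadraticMean, quadraticVar]
  grind

theorem sum_rationalWeight_mul_sq :
    ∑ i, rationalWeight i * (rationalMean i ^ 2 + rationalVar i) = 1 / 2 := by
  norm_num [rationalWeight, rationalMean, rationalVar]

theorem moments_eq {k : ℕ} (hk : k < 6) :
    ∑ i, Sum.elim quadraticWeight (-rationalWeight) i *
      gaussianMoment (Sum.elim quadraticMean rationalMean i)
        (Sum.elim quadraticVar rationalVar i) k = 0 := by
  have hr : √(21 : ℝ) ^ 2 = 21 := Real.sq_sqrt (by norm_num)
  simp only [Fintype.sum_sum_type, Sum.elim_inl, Sum.elim_inr, Fin.sum_univ_two]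
  simp only [quadraticWeight, quadraticMean, quadraticVar, rationalWeight, rationalMean,
    rationalVar, Pi.neg_apply, Matrix.cons_val_zero, Matrix.cons_val_one]
  -- Each moment identity is now polynomial in `r`, to be checked modulo `r ^ 2 = 21`.
  generalize √(21 : ℝ) = r at hr ⊢
  interval_cases k <;> simp only [gaussianMoment] <;> push_cast <;> grind

theorem variance_ofShift {t : ℝ} (ht : 0 ≤ t) {w μ v : Fin 2 → ℝ} (h0 : ∀ i, 0 ≤ w i)
    (h1 : w 0 + w 1 = 1) (hv : ∀ i, 0 ≤ v i) (hmean : ∑ i, w i * μ i = 0) :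
    Var[id; (GaussianMixture.ofShift t w μ v h0 h1).law] = ∑ i, w i * (μ i ^ 2 + v i) + t := by
  rw [GaussianMixture.variance_law]
  simp only [GaussianMixture.ofShift, hmean]
  simp only [Real.coe_toNNReal _ (add_nonneg ht (hv _)), Fin.sum_univ_two]
  linear_combination t * h1

theorem pairwiseSeparated_of_mem {c C : ℝ} {x y : Fin 2 → ℝ}
    (h : ∀ p ∈ [(x 0, x 1), (x 0, y 0), (x 0, y 1), (x 1, y 0), (x 1, y 1), (y 0, y 1)],
      p.1 + c ≤ p.2 ∧ p.2 ≤ p.1 + C ∨ p.2 + c ≤ p.1 ∧ p.1 ≤ p.2 + C) (hc : 0 ≤ c) :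
    PairwiseSeparated c C x y := by
  have key {p q : ℝ} (h : p + c ≤ q ∧ q ≤ p + C ∨ q + c ≤ p ∧ p ≤ q + C) :
      |p - q| ∈ Set.Icc c C ∧ |q - p| ∈ Set.Icc c C := by
    rw [abs_sub_comm q p, and_self]
    rcases h with h | h
    · rw [abs_of_nonpos (by linarith)]; constructor <;> linarith
    · rw [abs_of_nonneg (by linarith)]; constructor <;> linarith
  simp only [List.mem_cons, List.not_mem_nil, or_false, forall_eq_or_imp, forall_eq] at h
  obtain ⟨h1, h2, h3, h4, h5, h6⟩ := h
  rintro (i | i) (j | j) hij <;> fin_cases i <;> fin_cases j <;>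
    first
    | exact absurd rfl hij
    | exact (key h1).1 | exact (key h1).2 | exact (key h2).1 | exact (key h2).2
    | exact (key h3).1 | exact (key h3).2 | exact (key h4).1 | exact (key h4).2
    | exact (key h5).1 | exact (key h5).2 | exact (key h6).1 | exact (key h6).2

theorem pairwiseSeparated_means {C : ℝ} (hC : 2 ≤ C) :
    PairwiseSeparated (1 / 200) C quadraticMean rationalMean := by
  obtain ⟨h1, h2⟩ := sqrt_twentyOne_bounds
  refine pairwiseSeparated_of_mem ?_ (by norm_num)
  simp only [List.mem_cons, List.not_mem_nil, or_false, forall_eq_or_imp, forall_eq,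
    quadraticMean, rationalMean, Matrix.cons_val_zero, Matrix.cons_val_one]
  refine ⟨.inl ?_, .inr ?_, .inl ?_, .inr ?_, .inr ?_, .inl ?_⟩ <;> constructor <;> linarith

theorem pairwiseSeparated_vars {C : ℝ} (hC : 2 ≤ C) :
    PairwiseSeparated (1 / 200) C quadraticVar rationalVar := by
  obtain ⟨h1, h2⟩ := sqrt_twentyOne_bounds
  refine pairwiseSeparated_of_mem ?_ (by norm_num)
  simp only [List.mem_cons, List.not_mem_nil, or_false, forall_eq_or_imp, forall_eq,
    quadraticVar, rationalVar, Matrix.cons_val_zero, Matrix.cons_val_one]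
  refine ⟨.inr ?_, .inr ?_, .inr ?_, .inl ?_, .inl ?_, .inl ?_⟩ <;> constructor <;> linarith

theorem pairwiseSeparated_weights {C : ℝ} (hC : 2 ≤ C) :
    PairwiseSeparated (1 / 200) C quadraticWeight rationalWeight := by
  obtain ⟨h1, h2⟩ := sqrt_twentyOne_bounds
  refine pairwiseSeparated_of_mem ?_ (by norm_num)
  simp only [List.mem_cons, List.not_mem_nil, or_false, forall_eq_or_imp, forall_eq,
    quadraticWeight, rationalWeight, Matrix.cons_val_zero, Matrix.cons_val_one]
  refine ⟨.inr ?_, .inr ?_, .inr ?_, .inl ?_, .inl ?_, .inl ?_⟩ <;> constructor <;> linarith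

theorem PairwiseSeparated.add_left {c C : ℝ} {x y : Fin 2 → ℝ} (h : PairwiseSeparated c C x y)
    (t : ℝ) : PairwiseSeparated c C (fun i => t + x i) (fun i => t + y i) := by
  intro a b hab
  have := h hab
  rcases a with i | i <;> rcases b with j | j <;>
    simpa only [Sum.elim_inl, Sum.elim_inr, add_sub_add_left_eq_sub] using this

/-- The component of weight `3/4` suffices: `3/4 * (2/3 * 1/2) = 1/4`. The factor `2/3` uses `t / (t
+ v) ≥ 1/2 > 4/9`, valid as `v < 1/2 ≤ t`. -/
theorem le_pdf_ofShift_rational {t : ℝ} (ht : 1 / 2 ≤ t) (h0 : ∀ i, 0 ≤ rationalWeight i)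
    (y : ℝ) : 1 / 4 * gaussianPDFReal 0 t.toNNReal y ≤ (GaussianMixture.ofShift t rationalWeight
      rationalMean rationalVar h0 rationalWeight_sum).pdf y := by
  have ht0 : 0 < t := by linarith
  have hv := rationalVar_mem 1
  have h1 := mul_gaussianPDFReal_le ht0 hv.1 (rationalMean 1) y
  have hsq : 2 / 3 ≤ √(t / (t + rationalVar 1)) := by
    refine Real.le_sqrt_of_sq_le ?_
    rw [le_div_iff₀ (by linarith [hv.1])]
    linarith [hv.2]
  have hexp : 1 / 2 ≤ Real.exp (-rationalMean 1 ^ 2 / (2 * rationalVar 1)) := by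
    refine le_trans ?_ (Real.add_one_le_exp _)
    norm_num [rationalMean, rationalVar]
  have hφ := gaussianPDFReal_nonneg 0 t.toNNReal y
  have h2 : 2 / 3 * (1 / 2) * gaussianPDFReal 0 t.toNNReal y ≤
      gaussianPDFReal (rationalMean 1) (t + rationalVar 1).toNNReal y :=
    le_trans (by gcongr) h1
  simp only [GaussianMixture.pdf, GaussianMixture.ofShift, Fin.sum_univ_two]
  have h3 := mul_nonneg (h0 0)
    (gaussianPDFReal_nonneg (rationalMean 0) (t + rationalVar 0).toNNReal y)
  have hw : rationalWeight 1 = 3 / 4 := rfl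
  rw [hw]
  linarith

/-! ### Assembly. -/

theorem mainTheorem5 :
    ∃ c C : ℝ, 0 < c ∧ 0 < C ∧ ∀ σ : ℝ, 1 ≤ σ →
      ∃ F G : GaussianMixture,
        (∀ i, 0 < F.var i) ∧ (∀ i, 0 < G.var i) ∧
        (∀ i, c ≤ F.weight i) ∧ (∀ i, c ≤ G.weight i) ∧
        Var[id; F.law] = σ ^ 2 ∧ Var[id; G.law] = σ ^ 2 ∧
        PairwiseSeparated c C F.mean G.mean ∧
        PairwiseSeparated c C (fun i => (F.var i : ℝ)) (fun i => (G.var i : ℝ)) ∧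
        PairwiseSeparated c C F.weight G.weight ∧
        hellingerSq F.law G.law ≤ C * σ⁻¹ ^ 12 := by
  set w := Sum.elim quadraticWeight (-rationalWeight) with hw
  set μ := Sum.elim quadraticMean rationalMean with hμ
  set v := Sum.elim quadraticVar rationalVar with hvdef
  have hv (i : Fin 2 ⊕ Fin 2) : v i ∈ Set.Ioo 0 (1 / 2) := by
    rcases i with i | i
    · exact quadraticVar_mem i
    · exact rationalVar_mem i
  have hvv (i j : Fin 2 ⊕ Fin 2) : v i * v j < 1 / 4 := by
    calc v i * v j < 1 / 2 * (1 / 2) :=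
          mul_lt_mul'' (hv i).2 (hv j).2 (hv i).1.le (hv j).1.le
      _ = 1 / 4 := by norm_num
  -- The kernels are evaluated at `x = 1/t ≤ 2`, where `v i * v j < 1/4` keeps `1 - v i * v j * x ^
  -- 2` positive.
  obtain ⟨K, hK0, hK⟩ := exists_sum_mehlerKernel_le (b := 2) w μ v (fun i j x hx => by
    have h1 := mul_pos (hv i).1 (hv j).1
    have h2 : x ^ 2 ≤ 2 ^ 2 := pow_le_pow_left₀ hx.1 hx.2 2
    nlinarith [hvv i j]) (fun k hk => moments_eq hk)
  have hq0 (i : Fin 2) : 0 ≤ quadraticWeight i :=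
    le_trans (by norm_num) (quadraticWeight_ge i)
  have hr0 (i : Fin 2) : 0 ≤ rationalWeight i := le_trans (by norm_num) (rationalWeight_ge i)
  have hC : 2 ≤ 128 * K + 2 := by linarith
  -- `128 = 2 * 2 ^ 6`: the `2` is `1 / (2c)` with `c = 1/4`, and `2 ^ 6` comes from `t⁻¹ ≤ 2 σ⁻²`.
  -- The summand `2` covers the upper separation bounds.
  refine ⟨1 / 200, 128 * K + 2, by norm_num, by positivity, fun σ hσ => ?_⟩
  have hσ2 : 1 ≤ σ ^ 2 := one_le_pow₀ hσ
  obtain ⟨t, htdef⟩ : ∃ t, t = σ ^ 2 - 1 / 2 := ⟨_, rfl⟩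
  have ht : 1 / 2 ≤ t := by linarith
  have ht0 : 0 < t := by linarith
  refine ⟨.ofShift t quadraticWeight quadraticMean quadraticVar hq0 quadraticWeight_sum,
    .ofShift t rationalWeight rationalMean rationalVar hr0 rationalWeight_sum, ?_⟩
  set F := GaussianMixture.ofShift t quadraticWeight quadraticMean quadraticVar hq0
    quadraticWeight_sum with hFdef
  set G := GaussianMixture.ofShift t rationalWeight rationalMean rationalVar hr0
    rationalWeight_sum with hGdef
  have hFv (i : Fin 2) : (F.var i : ℝ) = t + quadraticVar i :=
    Real.coe_toNNReal _ (add_nonneg ht0.le (quadraticVar_mem i).1.le)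
  have hGv (i : Fin 2) : (G.var i : ℝ) = t + rationalVar i :=
    Real.coe_toNNReal _ (add_nonneg ht0.le (rationalVar_mem i).1.le)
  have hF (i : Fin 2) : 0 < F.var i :=
    Real.toNNReal_pos.2 (add_pos ht0 (quadraticVar_mem i).1)
  have hG (i : Fin 2) : 0 < G.var i :=
    Real.toNNReal_pos.2 (add_pos ht0 (rationalVar_mem i).1)
  refine ⟨hF, hG, quadraticWeight_ge, rationalWeight_ge, ?_, ?_, pairwiseSeparated_means hC, ?_,
    pairwiseSeparated_weights hC, ?_⟩
  · rw [hFdef, variance_ofShift ht0.le hq0 quadraticWeight_sum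
      (fun i => (quadraticVar_mem i).1.le) sum_quadraticWeight_mul_mean,
      sum_quadraticWeight_mul_sq, htdef]
    ring
  · rw [hGdef, variance_ofShift ht0.le hr0 rationalWeight_sum
      (fun i => (rationalVar_mem i).1.le) sum_rationalWeight_mul_mean,
      sum_rationalWeight_mul_sq, htdef]
    ring
  · simp only [hFv, hGv]
    exact (pairwiseSeparated_vars hC).add_left t
  · have hsub (y : ℝ) : F.pdf y - G.pdf y =
        ∑ i, w i * gaussianPDFReal (μ i) (t + v i).toNNReal y := by
      simp only [GaussianMixture.pdf, hFdef, hGdef, GaussianMixture.ofShift, hw, hμ, hvdef,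
        Fintype.sum_sum_type, Sum.elim_inl, Sum.elim_inr, Pi.neg_apply, neg_mul,
        Finset.sum_neg_distrib, sub_eq_add_neg]
    obtain ⟨hint, heq⟩ := integral_sq_sum_gaussianPDFReal_div ht0 w μ v (fun i => (hv i).1.le)
      fun i j => (hvv i j).trans_le (by nlinarith)
    have hle := GaussianMixture.hellingerSq_law_le hF hG (φ := gaussianPDFReal 0 t.toNNReal)
      (c := 1 / 4) (by norm_num)
      (fun x => gaussianPDFReal_pos _ _ _ (Real.toNNReal_pos.2 ht0).ne')
      (le_pdf_ofShift_rational ht hr0) (by simpa only [hsub] using hint)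
    simp only [hsub] at hle
    rw [heq] at hle
    -- Equivalent to `σ² ≤ 2t = 2σ² - 1`, that is, `σ² ≥ 1`.
    have hσt : t⁻¹ ≤ 2 * σ⁻¹ ^ 2 := by
      rw [inv_pow, ← div_eq_mul_inv, le_div_iff₀ (by positivity), inv_mul_le_iff₀ ht0]
      linarith
    have ht2 : t⁻¹ ≤ 2 := by
      rw [inv_le_comm₀ ht0 two_pos]; linarith
    calc _ ≤ 1 / (2 * (1 / 4)) * (K * t⁻¹ ^ 6) :=
          hle.trans (by gcongr; exact hK _ ⟨inv_pos.2 ht0, ht2⟩)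
      _ ≤ 1 / (2 * (1 / 4)) * (K * (2 * σ⁻¹ ^ 2) ^ 6) := by gcongr
      _ = 128 * K * σ⁻¹ ^ 12 := by ring
      _ ≤ _ := by
          gcongr
          linarith
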